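/- \textbf{Definitions.} A \emph{foliage tree} $\mathbf F$ on a topological space $X$ is a (set-theoretic) tree $T$, i.e. a strict partial order in which the set of predecessors of every node is well-ordered, together with a set $\mathbf F_x\subseteq X$ (the leaf at $x$) for each node $x\in T$. Let $\mathrm{sons}(x)$ denote the set of immediate successors of $x$. A \emph{$\pi$-tree} on $X$ is a foliage tree $\mathbf F$ on $X$ such that (i) $T$ is isomorphic to the tree $({}^{<\omega}\omega,\subset)$ of finite sequences of natural numbers ordered by proper extension; (ii) every leaf $\mathbf F_x$ is open in $X$, and the leaf at the least node is $X$; (iii) for every node $x$ (no node is maximal, by (i)), $\mathbf F_x$ is the union of the sets $\mathbf F_s$, $s\in\mathrm{sons}(x)$, and these sets are pairwise disjoint; (iv) for every branch (maximal chain) $B$ of $T$, the set $\bigcap_{x\in B}\mathbf F_x$ is a singleton; (v) for every $p\in X$ and every neighbourhood $U$ of $p$ there are a node $z$ with $p\in\mathbf F_z$ and a cofinite set $C\subseteq\mathrm{sons}(z)$ such that $\varnothing\neq\bigcup_{s\in C}\mathbf F_s\subseteq U$. The \emph{Baire space} $\mathcal N$ is ${}^{\omega}\omega$ with the product topology, where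 $\omega$ is discrete. The \emph{Sorgenfrey line} $\mathcal R_{\mathcal S}$ is $\mathbb R$ with the topology generated by the half-open intervals $[a,b)$. \textbf{Corollary.} Let $A$ be a set with $1\le|A|\le\omega$ and for each $\alpha\in A$ let $X_\alpha$ be a topological space that is (up to homeomorphism) either the Baire space $\mathcal N$, or a subspace of the Sorgenfrey line $\mathcal R_{\mathcal S}$ whose complement $\mathcal R_{\mathcal S}\setminus X_\alpha$ is at most countable. Then the product space $\prod_{\alpha\in A}X_\alpha$ has a $\pi$-tree. -/

import Mathlib

open Set Topology

namespace PiTree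

universe u

/-- `γ` π-refines `δ`: every nonempty member of `δ` contains a nonempty member of `γ`. -/
def PiRefines {X : Type u} (γ δ : Set (Set X)) : Prop :=
  ∀ D ∈ δ, D.Nonempty → ∃ G ∈ γ, G.Nonempty ∧ G ⊆ D

/-- A foliage tree with leaves in `X`: a set-theoretic tree (a partial order in which the set of
strict predecessors of every node is well-ordered) together with a leaf `leaf x ⊆ X` at each
node `x`. The nodes form a small type; the trees considered below are countable. -/
structure FoliageTree (X : Type u) where
  Node : Type
  order : PartialOrder Node
  wellOrdered : ∀ x : Node, IsWellOrder {v : Node // v < x} (fun v w => v.1 < w.1)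
  leaf : Node → Set X

attribute [instance] FoliageTree.order

namespace FoliageTree

variable {X : Type u} (F : FoliageTree X)

/-- The sons of a node are its immediate successors. -/
def sons (x : F.Node) : Set F.Node :=
  {s | x < s ∧ Ioi x ∩ Iio s = ∅}

/-- The union of the leaves at the nodes in `C`. -/
def flesh (C : Set F.Node) : Set X :=
  ⋃ x ∈ C, F.leaf x

/-- The fleshes of the cofinite sets of sons of `v`. -/
def shoot (v : F.Node) : Set (Set X) :=
  {G | ∃ C : Set F.Node, C ⊆ F.sons v ∧ (F.sons v \ C).Finite ∧ G = F.flesh C}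

/-- The nodes whose leaves contain the point `a`. -/
def scope (a : X) : Set F.Node :=
  {x | a ∈ F.leaf x}

/-- There are nodes, and the leaves along every branch (maximal chain) have exactly one
common point. -/
def HasStrictBranches : Prop :=
  Nonempty F.Node ∧
    ∀ B : Set F.Node, IsMaxChain (· ≤ ·) B → ∃ p : X, ⋂ x ∈ B, F.leaf x = {p}

/-- The leaf at every non-maximal node is the disjoint union of the leaves at its sons. -/
def IsLocallyStrict : Prop :=
  ∀ x : F.Node, ¬ IsMax x →
    F.leaf x = ⋃ s ∈ F.sons x, F.leaf s ∧ (F.sons x).PairwiseDisjoint F.leaf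

/-- The skeleton is isomorphic to the tree of all finite sequences of natural numbers,
strictly ordered by proper extension. -/
def IsOmegaOmegaTree : Prop :=
  Nonempty (((· < ·) : F.Node → F.Node → Prop) ≃r (fun s t : List ℕ => s <+: t ∧ s ≠ t))

variable [TopologicalSpace X]

/-- All leaves are open. -/
def IsOpenTree : Prop :=
  ∀ z : F.Node, IsOpen (F.leaf z)

/-- An open, locally strict foliage `ω,ω`-tree with strict branches, whose leaf at the least node
is the whole space. -/
structure IsBaireFoliageTree : Prop where
  isOpenTree : F.IsOpenTree
  isLocallyStrict : F.IsLocallyStrict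
  isOmegaOmegaTree : F.IsOmegaOmegaTree
  hasStrictBranches : F.HasStrictBranches
  leaf_least : ∃ r : F.Node, IsBot r ∧ F.leaf r = univ

def GrowsInto : Prop :=
  ∀ p : X, ∀ U ∈ 𝓝 p, ∃ z ∈ F.scope p, PiRefines (F.shoot z) {U}

def IsPiTree : Prop :=
  F.IsBaireFoliageTree ∧ F.GrowsInto

end FoliageTree

/-- The space `X` has a π-tree. -/
def HasPiTree (X : Type u) [TopologicalSpace X] : Prop :=
  ∃ F : FoliageTree X, F.IsPiTree

/-- The Sorgenfrey line: the real line with the topology generated by the half-open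
intervals `[a, b)`. -/
def SorgenfreyLine : Type := ℝ

instance : TopologicalSpace SorgenfreyLine :=
  TopologicalSpace.generateFrom {s : Set ℝ | ∃ a b : ℝ, s = Ico a b}

end PiTree

/-!
Call a bijection `φ` of `X` onto `ℕ → ℕ × ℕ` a pair code if it is continuous and if, for every
neighbourhood `U` of `p` and all large `n`, the points whose code agrees with that of `p` below `n`
and whose `n`-th pair has a large first entry lie in `U`. Writing out the two entries of each pair
one after the other turns a pair code into a `π`-tree: the growth condition then concerns a single
entry of the sequence, hence cofinitely many sons of one node.

Pair codes pass to countable products. Distribute the pairs `(α, i)` into finite stages, so that the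
stages below `n` contain the first `n` entries of every coordinate from a finite set that grows with
`n`, and let the height of a stage be the minimum of the first entries occurring in it: a large
height makes the first entry large in each of these coordinates at once.

For a co-countable set of reals with the Sorgenfrey topology, split a half-open interval `[u, v)`
repeatedly. Each step discards at most one point, namely one from an enumeration of the complement,
keeps the closures of the pieces inside the rest of the interval, halves lengths, and lets the
pieces of large first index approach `v`. Every branch closes down to exactly one point, and that
point has not been discarded.
-/

namespace PiTree

open Filter Function

section Sequences

variable {C X : Type*}

theorem exists_forall_res {P : List C → Prop} (hnil : P []) (hcons : ∀ l, P l → ∃ c, P (c :: l)) :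
    ∃ y : ℕ → C, ∀ n, P (PiNat.res y n) := by
  have : Nonempty C := (hcons [] hnil).nonempty
  choose! next hnext using hcons
  let node : ℕ → List C := fun n => Nat.rec [] (fun _ l => next l :: l) n
  have hnode (n : ℕ) : PiNat.res (fun k => next (node k)) n = node n := by
    induction n with
    | zero => rfl
    | succ n ih => rw [PiNat.res_succ, ih]
  refine ⟨fun k => next (node k), fun n => ?_⟩
  rw [hnode]
  induction n with
  | zero => exact hnil
  | succ n ih => exact hnext _ ih

theorem exists_cons_suffix_of_suffix_of_ne {s t : List C} (hst : s <:+ t) (hne : s ≠ t) :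
    ∃ c, c :: s <:+ t := by
  obtain ⟨l, rfl⟩ := hst
  rcases List.eq_nil_or_concat l with rfl | ⟨l, c, rfl⟩
  · exact absurd rfl hne
  · exact ⟨c, l, by simp⟩

theorem mem_of_isMaxChain_of_forall_or {r : X → X → Prop} {B : Set X} (hB : IsMaxChain r B)
    {a : X} (ha : ∀ b ∈ B, r a b ∨ r b a) : a ∈ B := by
  rw [hB.2 (hB.1.insert fun b hb _ => ha b hb) (subset_insert a B)]
  exact mem_insert a B

theorem exists_eq_range_res_of_isMaxChain [Nonempty C] {B : Set (List C)}
    (hB : IsMaxChain (· <:+ ·) B) : ∃ y : ℕ → C, B = range (PiNat.res y) := by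
  have htotal {s t : List C} (hs : s ∈ B) (ht : t ∈ B) : s <:+ t ∨ t <:+ s := hB.1.total hs ht
  have hdown {s t : List C} (ht : t ∈ B) (hst : s <:+ t) : s ∈ B :=
    mem_of_isMaxChain_of_forall_or hB fun r hr => (htotal ht hr).elim
      (fun htr => Or.inl (hst.trans htr)) fun hrt => List.suffix_or_suffix_of_suffix hst hrt
  have hextend (s : List C) (hs : s ∈ B) : ∃ c, c :: s ∈ B := by
    by_cases hmax : ∀ t ∈ B, t <:+ s
    · exact ⟨Classical.arbitrary C, mem_of_isMaxChain_of_forall_or hB fun t ht =>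
        Or.inr ((hmax t ht).trans (List.suffix_cons _ _))⟩
    · push Not at hmax
      obtain ⟨t, ht, hts⟩ := hmax
      obtain ⟨c, hc⟩ := exists_cons_suffix_of_suffix_of_ne ((htotal hs ht).resolve_right hts)
        fun h => hts (h ▸ List.suffix_refl s)
      exact ⟨c, hdown ht hc⟩
  obtain ⟨y, hy⟩ := exists_forall_res
    (mem_of_isMaxChain_of_forall_or hB fun _ _ => Or.inl List.nil_suffix) hextend
  refine ⟨y, Subset.antisymm (fun s hs => ⟨s.length, ?_⟩) (range_subset_iff.2 hy)⟩
  have hlength : (PiNat.res y s.length).length = s.length := PiNat.res_length y _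
  exact (htotal (hy s.length) hs).elim (·.eq_of_length hlength)
    fun h => (h.eq_of_length hlength.symm).symm

theorem res_eq_res_of_mem {A : List C → Set X} (hanti : CantorScheme.Antitone A)
    (hdisj : CantorScheme.Disjoint A) {x : X} {y z : ℕ → C} {n : ℕ} (hy : x ∈ A (PiNat.res y n))
    (hz : x ∈ A (PiNat.res z n)) : PiNat.res y n = PiNat.res z n := by
  induction n with
  | zero => rfl
  | succ n ih =>
    rw [PiNat.res_succ] at hy hz
    have hres := ih (hanti _ _ hy) (hanti _ _ hz)
    rw [← hres] at hz
    have hentry : y n = z n := by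
      by_contra hne
      exact disjoint_left.1 (hdisj _ hne) hy hz
    rw [PiNat.res_succ, PiNat.res_succ, hres, hentry]

theorem exists_equiv_of_cantorScheme {A : List C → Set X} (hanti : CantorScheme.Antitone A)
    (hdisj : CantorScheme.Disjoint A) (hroot : A [] = univ) (hcover : ∀ l, A l ⊆ ⋃ c, A (c :: l))
    (hbranch : ∀ y : ℕ → C, ∃! x, ∀ n, x ∈ A (PiNat.res y n)) :
    ∃ φ : X ≃ (ℕ → C), ∀ x y n, x ∈ A (PiNat.res y n) ↔ PiNat.res (φ x) n = PiNat.res y n := by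
  have hcode (x : X) : ∃ y : ℕ → C, ∀ n, x ∈ A (PiNat.res y n) :=
    exists_forall_res (P := fun l => x ∈ A l) (hroot ▸ mem_univ x)
      fun l hl => mem_iUnion.1 (hcover l hl)
  choose code hcode using hcode
  have hinj : Injective code := fun x x' h =>
    (hbranch (code x)).unique (hcode x) (h ▸ hcode x')
  have hsurj : Surjective code := fun y => by
    obtain ⟨x, hx, -⟩ := hbranch y
    exact ⟨x, PiNat.res_injective <| funext fun n =>
      res_eq_res_of_mem hanti hdisj (hcode x n) (hx n)⟩
  exact ⟨Equiv.ofBijective code ⟨hinj, hsurj⟩, fun x y n =>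
    ⟨fun hx => res_eq_res_of_mem hanti hdisj (hcode x n) hx, fun h => h ▸ hcode x n⟩⟩

theorem continuous_of_forall_mem_iff_res_eq [TopologicalSpace C] [TopologicalSpace X]
    {A : List C → Set X} (hopen : ∀ l, IsOpen (A l)) {φ : X → ℕ → C}
    (hφ : ∀ x y n, x ∈ A (PiNat.res y n) ↔ PiNat.res (φ x) n = PiNat.res y n) : Continuous φ := by
  refine continuous_pi fun n => ((IsLocallyConstant.iff_eventually_eq _).2 fun x => ?_).continuous
  filter_upwards [(hopen _).mem_nhds ((hφ x (φ x) (n + 1)).2 rfl)] with x' hx'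
  exact PiNat.res_eq_res.1 ((hφ _ _ _).1 hx') n.lt_succ_self

end Sequences

/-- Finite sequences ordered by extension. The last entry of a sequence is the head of the list, as
in `PiNat.res`, so extensions are prepended and the order is the suffix order. -/
@[reducible] def suffixOrder (C : Type*) : PartialOrder (List C) where
  le s t := s <:+ t
  lt s t := s <:+ t ∧ s ≠ t
  lt_iff_le_not_ge _ _ := and_congr_right fun h =>
    not_congr ⟨fun e => e ▸ List.suffix_refl _, fun h' => antisymm h h'⟩
  le_refl := List.suffix_refl
  le_trans _ _ _ := List.IsSuffix.trans
  le_antisymm _ _ := antisymm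

theorem isWellOrder_suffixOrder_lt {C : Type*} (t : List C) :
    IsWellOrder {v : List C // v <:+ t ∧ v ≠ t} fun v w => v.1 <:+ w.1 ∧ v.1 ≠ w.1 where
  wf := Subrelation.wf (fun {v w} (h : v.1 <:+ w.1 ∧ v.1 ≠ w.1) =>
      h.1.length_le.lt_of_ne fun e => h.2 (h.1.eq_of_length e))
    (measure fun v : {v : List C // v <:+ t ∧ v ≠ t} => v.1.length).wf
  trichotomous v w hvw hwv := by
    by_contra hne
    rcases List.suffix_or_suffix_of_suffix v.2.1 w.2.1 with h | h
    · exact hvw ⟨h, fun e => hne (Subtype.ext e)⟩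
    · exact hwv ⟨h, fun e => hne (Subtype.ext e.symm)⟩

/-- The foliage tree of a coding `ψ` of points by sequences: the leaf at a finite sequence is the
set of points whose code extends it. -/
def codeTree {X : Type*} (ψ : X → ℕ → ℕ) : FoliageTree X where
  Node := List ℕ
  order := suffixOrder ℕ
  wellOrdered := isWellOrder_suffixOrder_lt
  leaf s := {x | PiNat.res (ψ x) s.length = s}

section CodeTree

variable {X : Type*} (ψ : X → ℕ → ℕ)

/-- The initial segment of length `n` of the sequence `y`, as a node of `codeTree ψ`. -/
def codeNode (y : ℕ → ℕ) (n : ℕ) : (codeTree ψ).Node := PiNat.res y n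

/-- The extension of the node `s` of `codeTree ψ` by the entry `c`. -/
def codeSon (s : (codeTree ψ).Node) (c : ℕ) : (codeTree ψ).Node := List.cons c s

variable {ψ}

theorem mem_leaf_codeNode {x : X} {y : ℕ → ℕ} {n : ℕ} :
    x ∈ (codeTree ψ).leaf (codeNode ψ y n) ↔ ∀ i < n, ψ x i = y i := by
  change PiNat.res (ψ x) (PiNat.res y n).length = PiNat.res y n ↔ _
  rw [PiNat.res_length, PiNat.res_eq_res]

theorem mem_leaf_codeSon {s : (codeTree ψ).Node} {c : ℕ} {x : X} :
    x ∈ (codeTree ψ).leaf (codeSon ψ s c) ↔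
      x ∈ (codeTree ψ).leaf s ∧ ψ x (List.length s) = c :=
  List.cons_eq_cons.trans and_comm

theorem mem_leaf_codeSon_codeNode {x : X} {y : ℕ → ℕ} {n c : ℕ} :
    x ∈ (codeTree ψ).leaf (codeSon ψ (codeNode ψ y n) c) ↔
      (∀ i < n, ψ x i = y i) ∧ ψ x n = c := by
  have hlength : List.length (codeNode ψ y n) = n := PiNat.res_length y n
  rw [mem_leaf_codeSon, mem_leaf_codeNode, hlength]

variable (ψ)

theorem codeTree_sons (s : (codeTree ψ).Node) : (codeTree ψ).sons s = range (codeSon ψ s) := by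
  have hlt (c : ℕ) : s < codeSon ψ s c := ⟨List.suffix_cons c s, (List.cons_ne_self c s).symm⟩
  ext t
  constructor
  · rintro ⟨⟨hsuffix, hne⟩, hempty⟩
    obtain ⟨c, hc⟩ := exists_cons_suffix_of_suffix_of_ne hsuffix hne
    refine ⟨c, ?_⟩
    by_contra hct
    exact eq_empty_iff_forall_notMem.1 hempty (codeSon ψ s c) ⟨hlt c, hc, hct⟩
  · rintro ⟨c, rfl⟩
    refine ⟨hlt c, eq_empty_of_forall_notMem ?_⟩
    rintro t ⟨hst, htc, htc_ne⟩
    rcases List.suffix_cons_iff.1 htc with h | h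
    · exact htc_ne h
    · exact hst.2 (antisymm hst.1 h)

theorem codeTree_isLocallyStrict : (codeTree ψ).IsLocallyStrict := by
  intro s _
  rw [codeTree_sons ψ s, biUnion_range]
  constructor
  · ext x
    rw [mem_iUnion]
    exact ⟨fun hx => ⟨ψ x (List.length s), mem_leaf_codeSon.2 ⟨hx, rfl⟩⟩,
      fun ⟨_, hx⟩ => (mem_leaf_codeSon.1 hx).1⟩
  · rintro _ ⟨c, rfl⟩ _ ⟨c', rfl⟩ hne
    refine disjoint_left.2 fun x hx hx' => hne ?_
    rw [← (mem_leaf_codeSon.1 hx).2, ← (mem_leaf_codeSon.1 hx').2]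

theorem codeTree_isOmegaOmegaTree : (codeTree ψ).IsOmegaOmegaTree :=
  ⟨⟨⟨List.reverse, List.reverse, List.reverse_reverse, List.reverse_reverse⟩,
    and_congr List.reverse_prefix (not_congr List.reverse_inj)⟩⟩

variable {ψ}

theorem codeTree_hasStrictBranches (hψ : Bijective ψ) : (codeTree ψ).HasStrictBranches := by
  refine ⟨⟨codeNode ψ 0 0⟩, fun B hB => ?_⟩
  obtain ⟨y, hy⟩ := exists_eq_range_res_of_isMaxChain (B := B) hB
  obtain rfl : B = range (codeNode ψ y) := hy
  obtain ⟨p, rfl⟩ := hψ.surjective y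
  refine ⟨p, Set.ext fun x => ?_⟩
  rw [biInter_range, mem_iInter]
  simp only [mem_leaf_codeNode]
  exact ⟨fun h => hψ.injective (funext fun n => h (n + 1) n n.lt_succ_self),
    fun h _ _ _ => h ▸ rfl⟩

variable [TopologicalSpace X]

theorem codeTree_isOpenTree (hψ : Continuous ψ) : (codeTree ψ).IsOpenTree := by
  refine fun s => isOpen_iff_mem_nhds.2 fun x hx => ?_
  obtain ⟨y, n, rfl⟩ : ∃ y n, codeNode ψ y n = s := ⟨ψ x, List.length s, hx⟩
  rw [mem_leaf_codeNode] at hx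
  filter_upwards [((PiNat.isOpen_cylinder (fun _ : ℕ => ℕ) y n).preimage hψ).mem_nhds hx]
    with x' hx'
  exact mem_leaf_codeNode.2 hx'

theorem codeTree_isBaireFoliageTree (hψ : Continuous ψ) (hb : Bijective ψ) :
    (codeTree ψ).IsBaireFoliageTree where
  isOpenTree := codeTree_isOpenTree hψ
  isLocallyStrict := codeTree_isLocallyStrict ψ
  isOmegaOmegaTree := codeTree_isOmegaOmegaTree ψ
  hasStrictBranches := codeTree_hasStrictBranches hb
  leaf_least := ⟨codeNode ψ 0 0, fun _ => List.nil_suffix, eq_univ_of_forall fun _ => rfl⟩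

theorem codeTree_growsInto (hsurj : Surjective ψ)
    (hgrow : ∀ p, ∀ U ∈ 𝓝 p, ∃ n K, ∀ x, (∀ i < n, ψ x i = ψ p i) → K ≤ ψ x n → x ∈ U) :
    (codeTree ψ).GrowsInto := by
  intro p U hU
  obtain ⟨n, K, hK⟩ := hgrow p U hU
  refine ⟨codeNode ψ (ψ p) n, mem_leaf_codeNode.2 fun _ _ => rfl, ?_⟩
  rintro _ rfl -
  refine ⟨_, ⟨codeSon ψ (codeNode ψ (ψ p) n) '' Ici K, ?_, ?_, rfl⟩, ?_, ?_⟩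
  · rw [codeTree_sons]
    exact image_subset_range _ _
  · rw [codeTree_sons, ← image_univ]
    refine ((finite_Iio K).image (codeSon ψ (codeNode ψ (ψ p) n))).subset ?_
    rw [sdiff_subset_iff, ← image_union, Ici_union_Iio]
  · obtain ⟨x, hx⟩ := hsurj (update (ψ p) n K)
    refine ⟨x, mem_biUnion (mem_image_of_mem _ self_mem_Ici)
      (mem_leaf_codeSon_codeNode.2 ⟨fun i hi => ?_, ?_⟩)⟩
    · rw [hx, update_of_ne hi.ne]
    · rw [hx, update_self]
  · refine iUnion₂_subset ?_
    rintro _ ⟨c, hc, rfl⟩ x hx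
    obtain ⟨hagree, rfl⟩ := mem_leaf_codeSon_codeNode.1 hx
    exact hK x hagree hc

end CodeTree

/-- A code of the points of `X` by sequences of pairs of natural numbers: for `n` large, the points
that share the first `n` pairs of `p` and have a large first entry in the next pair lie in a
prescribed neighbourhood of `p`. The second entry leaves infinitely many pairs with any given first
entry, which is what makes the notion stable under products. -/
structure IsPairCode {X : Type*} [TopologicalSpace X] (φ : X ≃ (ℕ → ℕ × ℕ)) : Prop where
  continuous : Continuous φ
  grows : ∀ p, ∀ U ∈ 𝓝 p, ∃ N, ∀ n ≥ N, ∃ K, ∀ x, (∀ i < n, φ x i = φ p i) →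
    K ≤ (φ x n).1 → x ∈ U

/-- The existence of a pair code, a property of spaces that is stable under countable products and
implies the existence of a `π`-tree. -/
def HasPairCode (X : Type*) [TopologicalSpace X] : Prop :=
  ∃ φ : X ≃ (ℕ → ℕ × ℕ), IsPairCode φ

/-- Sequences of pairs, written out as sequences of numbers: the entries of the `n`-th pair become
the entries `2 * n` and `2 * n + 1`. -/
def interleave : (ℕ → ℕ × ℕ) ≃ (ℕ → ℕ) :=
  (Equiv.arrowProdEquivProdArrow ℕ (fun _ => ℕ) (fun _ => ℕ)).trans
    ((Equiv.sumArrowEquivProdArrow ℕ ℕ ℕ).symm.trans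
      (Equiv.arrowCongr Equiv.natSumNatEquivNat (Equiv.refl ℕ)))

theorem interleave_two_mul (y : ℕ → ℕ × ℕ) (n : ℕ) : interleave y (2 * n) = (y n).1 := by
  have hn : Equiv.natSumNatEquivNat.symm (2 * n) = Sum.inl n := by
    rw [Equiv.symm_apply_eq, Equiv.natSumNatEquivNat_apply, Sum.elim_inl]
  simp [interleave, hn]

theorem interleave_two_mul_add_one (y : ℕ → ℕ × ℕ) (n : ℕ) :
    interleave y (2 * n + 1) = (y n).2 := by
  have hn : Equiv.natSumNatEquivNat.symm (2 * n + 1) = Sum.inr n := by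
    rw [Equiv.symm_apply_eq, Equiv.natSumNatEquivNat_apply, Sum.elim_inr]
  simp [interleave, hn]

theorem continuous_interleave : Continuous interleave := by
  refine continuous_pi fun n => ?_
  rcases Nat.even_or_odd' n with ⟨k, rfl | rfl⟩
  · simp only [interleave_two_mul]; fun_prop
  · simp only [interleave_two_mul_add_one]; fun_prop

namespace HasPairCode

variable {X : Type*} [TopologicalSpace X]

theorem hasPiTree (h : HasPairCode X) : HasPiTree X := by
  obtain ⟨φ, hφ⟩ := h
  have hb := (φ.trans interleave).bijective
  refine ⟨codeTree (φ.trans interleave), codeTree_isBaireFoliageTree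
    (continuous_interleave.comp hφ.continuous) hb, codeTree_growsInto hb.surjective ?_⟩
  intro p U hU
  obtain ⟨N, hN⟩ := hφ.grows p U hU
  obtain ⟨K, hK⟩ := hN N le_rfl
  refine ⟨2 * N, K, fun x hx hx' => hK x (fun i hi => ?_) ?_⟩
  · have hfst := hx (2 * i) (by omega)
    have hsnd := hx (2 * i + 1) (by omega)
    simp only [Equiv.trans_apply, interleave_two_mul, interleave_two_mul_add_one] at hfst hsnd
    exact Prod.ext hfst hsnd
  · simpa only [Equiv.trans_apply, interleave_two_mul] using hx'

theorem of_homeomorph {Y : Type*} [TopologicalSpace Y] (hY : HasPairCode Y) (h : X ≃ₜ Y) :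
    HasPairCode X := by
  obtain ⟨φ, hφ⟩ := hY
  refine ⟨h.toEquiv.trans φ, hφ.continuous.comp h.continuous, fun p U hU => ?_⟩
  have hU' : h.symm ⁻¹' U ∈ 𝓝 (h p) :=
    h.symm.continuous.continuousAt.preimage_mem_nhds (by rwa [h.symm_apply_apply])
  obtain ⟨N, hN⟩ := hφ.grows (h p) _ hU'
  refine ⟨N, fun n hn => ?_⟩
  obtain ⟨K, hK⟩ := hN n hn
  exact ⟨K, fun x hx hx' => by simpa using hK (h x) hx hx'⟩

end HasPairCode

theorem hasPairCode_nat_nat : HasPairCode (ℕ → ℕ) := by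
  refine ⟨Equiv.arrowCongr (Equiv.refl ℕ) Nat.pairEquiv.symm, ?_, fun p U hU => ?_⟩
  · exact continuous_pi fun n =>
      (continuous_of_discreteTopology (f := Nat.pairEquiv.symm)).comp (continuous_apply n)
  · obtain ⟨V, hVU, hV, hpV⟩ := mem_nhds_iff.1 hU
    obtain ⟨_, ⟨q, N, rfl⟩, hpq, hqV⟩ :=
      (PiNat.isTopologicalBasis_cylinders fun _ => ℕ).exists_subset_of_mem_open hpV hV
    rw [← PiNat.mem_cylinder_iff_eq.1 hpq] at hqV
    exact ⟨N, fun n hn => ⟨0, fun x hx _ => hVU (hqV fun i hi =>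
      Nat.pairEquiv.symm.injective (hx i (hi.trans_le hn)))⟩⟩

section Products

theorem exists_equiv_prod_of_infinite_fibers {B : Type*} [Countable B] {f : B → ℕ}
    (hf : ∀ m, Infinite {b // f b = m}) : ∃ e : B ≃ ℕ × ℕ, ∀ b, (e b).1 = f b := by
  have (m : ℕ) : Nonempty ({b // f b = m} ≃ ℕ) := nonempty_equiv_of_countable
  exact ⟨(Equiv.sigmaFiberEquiv f).symm.trans ((Equiv.sigmaCongrRight fun m =>
    (this m).some).trans (Equiv.sigmaEquivProd ℕ ℕ)), fun b => rfl⟩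

theorem HasPairCode.of_heights {X : Type*} [TopologicalSpace X] {C : ℕ → Type*}
    [∀ n, Countable (C n)] [∀ n, TopologicalSpace (C n)] [∀ n, DiscreteTopology (C n)]
    {height : ∀ n, C n → ℕ} (hheight : ∀ n m, Infinite {b // height n b = m})
    (Φ : X ≃ ∀ n, C n) (hΦ : Continuous Φ)
    (hgrow : ∀ p, ∀ U ∈ 𝓝 p, ∃ N, ∀ n ≥ N, ∃ K, ∀ x, (∀ i < n, Φ x i = Φ p i) →
      K ≤ height n (Φ x n) → x ∈ U) : HasPairCode X := by
  choose e he using fun n => exists_equiv_prod_of_infinite_fibers (hheight n)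
  refine ⟨Φ.trans (Equiv.piCongrRight e), continuous_pi fun n => ?_, fun p U hU => ?_⟩
  · exact (continuous_of_discreteTopology (f := e n)).comp ((continuous_apply n).comp hΦ)
  · obtain ⟨N, hN⟩ := hgrow p U hU
    refine ⟨N, fun n hn => (hN n hn).imp fun K hK x hx hxK => hK x (fun i hi => ?_) ?_⟩
    · exact (e i).injective (hx i hi)
    · exact (he n (Φ x n)).subst hxK

theorem infinite_setOf_iInf_fst_eq {ι : Type*} [Nonempty ι] (m : ℕ) :
    Infinite {b : ι → ℕ × ℕ // ⨅ q, (b q).1 = m} :=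
  Infinite.of_injective
    (fun j : ℕ => (⟨fun _ => (m, j), ciInf_const⟩ : {b : ι → ℕ × ℕ // ⨅ q, (b q).1 = m}))
    fun _ _ h => congrArg Prod.snd (congrFun (congrArg Subtype.val h) (Classical.arbitrary ι))

theorem exists_finite_sublevels_of_countable (A : Type*) [Nonempty A] [Countable A] :
    ∃ k : A → ℕ, (∀ n, {α | k α ≤ n}.Finite) ∧ ∃ α, k α = 0 := by
  obtain ⟨ι, hι⟩ := Countable.exists_injective_nat A
  let α₀ : A := Classical.arbitrary A
  refine ⟨fun α => ι α - ι α₀, fun n => ?_, α₀, Nat.sub_self _⟩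
  refine ((finite_Iic (n + ι α₀)).preimage hι.injOn).subset fun α hα => ?_
  exact Nat.sub_le_iff_le_add.1 hα

variable {A C : Type*} (k : A → ℕ)

/-- The stage at which the `i`-th entry of the code of the coordinate `α` enters the code of a point
of a product, where `k α` is the first stage that involves `α`. -/
def stage (q : A × ℕ) : ℕ := max (k q.1) q.2

variable {k}

theorem finite_stage_fiber (hk : ∀ n, {α | k α ≤ n}.Finite) (n : ℕ) :
    Finite {q // stage k q = n} :=
  (((hk n).prod (finite_Iic n)).subset fun q (hq : stage k q = n) =>
    ⟨(le_max_left _ _).trans hq.le, (le_max_right _ _).trans hq.le⟩).to_subtype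

theorem nonempty_stage_fiber {α : A} (hα : k α = 0) (n : ℕ) : Nonempty {q // stage k q = n} :=
  ⟨⟨(α, n), by rw [stage, hα, Nat.zero_max]⟩⟩

variable {X : A → Type*} (k)

/-- The code of a point of a product, assembled from codes of its coordinates: its `n`-th entry
collects the entries of the coordinate codes that belong to stage `n`. -/
def productCode (φ : ∀ α, X α ≃ (ℕ → C)) : (∀ α, X α) ≃ ∀ n, {q // stage k q = n} → C :=
  (Equiv.piCongrRight φ).trans ((Equiv.curry A ℕ C).symm.trans
    ((Equiv.arrowCongr (Equiv.sigmaFiberEquiv (stage k)).symm (Equiv.refl C)).trans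
      (Equiv.piCurry fun _ _ => C)))

variable [∀ α, TopologicalSpace (X α)]

theorem continuous_productCode [TopologicalSpace C] {φ : ∀ α, X α ≃ (ℕ → C)}
    (hφ : ∀ α, Continuous (φ α)) : Continuous (productCode k φ) :=
  continuous_pi fun _ => continuous_pi fun q =>
    (continuous_apply q.1.2).comp ((hφ q.1.1).comp (continuous_apply q.1.1))

theorem productCode_grows {φ : ∀ α, X α ≃ (ℕ → ℕ × ℕ)} (hφ : ∀ α, IsPairCode (φ α))
    (p : ∀ α, X α) {U : Set (∀ α, X α)} (hU : U ∈ 𝓝 p) :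
    ∃ N, ∀ n ≥ N, ∃ K, ∀ x, (∀ i < n, productCode k φ x i = productCode k φ p i) →
      K ≤ ⨅ q, (productCode k φ x n q).1 → x ∈ U := by
  rw [nhds_pi, Filter.mem_pi] at hU
  obtain ⟨F, hF, V, hV, hVU⟩ := hU
  choose N hN using fun α => (hφ α).grows (p α) (V α) (hV α)
  obtain ⟨M, hM⟩ := (hF.image fun α => max (N α) (k α + 1)).bddAbove
  refine ⟨M, fun n hn => ?_⟩
  have hlarge (α : A) (hα : α ∈ F) : N α ≤ n ∧ k α < n :=
    max_le_iff.1 ((hM (mem_image_of_mem _ hα)).trans hn)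
  choose! K hK using fun α (hα : α ∈ F) => hN α n (hlarge α hα).1
  obtain ⟨K', hK'⟩ := (hF.image K).bddAbove
  refine ⟨K', fun x hx hxn => hVU fun α hα => hK α hα (x α) (fun i hi => ?_) ?_⟩
  · have hstage : stage k (α, i) < n := max_lt (hlarge α hα).2 hi
    exact congrFun (hx _ hstage) ⟨(α, i), rfl⟩
  · let q : {q // stage k q = n} := ⟨(α, n), max_eq_right (hlarge α hα).2.le⟩
    calc K α ≤ K' := hK' (mem_image_of_mem K hα)
      _ ≤ ⨅ q, (productCode k φ x n q).1 := hxn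
      _ ≤ (φ α (x α) n).1 := ciInf_le (OrderBot.bddBelow _) q

theorem HasPairCode.pi [Nonempty A] [Countable A] (h : ∀ α, HasPairCode (X α)) :
    HasPairCode (∀ α, X α) := by
  choose φ hφ using h
  obtain ⟨k, hk, α, hα⟩ := exists_finite_sublevels_of_countable A
  have := finite_stage_fiber hk
  have := nonempty_stage_fiber hα
  exact HasPairCode.of_heights (fun _ => infinite_setOf_iInf_fst_eq) (productCode k φ)
    (continuous_productCode k fun α => (hφ α).continuous) fun p _ hU => productCode_grows k hφ p hU

end Products

/-- The half-open interval with the given pair of endpoints. -/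
abbrev pairIco {α : Type*} [Preorder α] (p : α × α) : Set α := Ico p.1 p.2

/-- The half-open intervals with endpoints `Q i` are nonempty and partition the set `O`. -/
structure IsIcoPartition {ι α : Type*} [Preorder α] (O : Set α) (Q : ι → α × α) : Prop where
  lt : ∀ i, (Q i).1 < (Q i).2
  pairwise_disjoint : Pairwise (Disjoint on fun i => pairIco (Q i))
  iUnion_eq : ⋃ i, pairIco (Q i) = O

namespace IsIcoPartition

section Preorder

variable {ι κ α : Type*} [Preorder α]

theorem subset {O : Set α} {Q : ι → α × α} (hQ : IsIcoPartition O Q) (i : ι) :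
    pairIco (Q i) ⊆ O :=
  hQ.iUnion_eq ▸ subset_iUnion (fun i => pairIco (Q i)) i

theorem comp_equiv {O : Set α} {Q : ι → α × α} (hQ : IsIcoPartition O Q) (e : κ ≃ ι) :
    IsIcoPartition O (Q ∘ e) where
  lt _ := hQ.lt _
  pairwise_disjoint := hQ.pairwise_disjoint.comp_of_injective e.injective
  iUnion_eq := (e.surjective.iUnion_comp fun i => pairIco (Q i)).trans hQ.iUnion_eq

theorem iUnion {P : ι → Set α} (hP : Pairwise (Disjoint on P)) {R : ι → κ → α × α}
    (hR : ∀ i, IsIcoPartition (P i) (R i)) :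
    IsIcoPartition (⋃ i, P i) fun c : ι × κ => R c.1 c.2 where
  lt c := (hR c.1).lt c.2
  pairwise_disjoint := by
    rintro ⟨i, j⟩ ⟨i', j'⟩ hne
    rcases eq_or_ne i i' with rfl | hi
    · exact (hR i).pairwise_disjoint fun hj => hne (Prod.ext rfl hj)
    · exact (hP hi).mono ((hR i).subset j) ((hR i').subset j')
  iUnion_eq := by
    rw [iUnion_prod']
    exact iUnion_congr fun i => (hR i).iUnion_eq

theorem refine {O E : Set α} {Q : ι → α × α} (hQ : IsIcoPartition O Q) {R : ι → κ → α × α}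
    (hR : ∀ i, IsIcoPartition (pairIco (Q i) \ E) (R i)) :
    IsIcoPartition (O \ E) fun c : ι × κ => R c.1 c.2 := by
  rw [← hQ.iUnion_eq, iUnion_sdiff]
  exact iUnion (fun _ _ h => (hQ.pairwise_disjoint h).mono sdiff_subset sdiff_subset) hR

theorem union {O O' : Set α} {Q Q' : κ → α × α} (hQ : IsIcoPartition O Q)
    (hQ' : IsIcoPartition O' Q') (h : Disjoint O O') :
    IsIcoPartition (O ∪ O') fun c : Bool × κ => cond c.1 Q Q' c.2 := by
  rw [union_eq_iUnion]
  exact iUnion (pairwise_disjoint_on_bool.2 h) (R := fun b => cond b Q Q') fun b => by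
    cases b
    exacts [hQ', hQ]

end Preorder

variable {α : Type*} [LinearOrder α] [TopologicalSpace α] [OrderTopology α]

theorem of_strictMono {t : ℕ → α} {v : α} (ht : StrictMono t) (hv : Tendsto t atTop (𝓝 v)) :
    IsIcoPartition (Ico (t 0) v) fun j => (t j, t (j + 1)) where
  lt j := ht j.lt_succ_self
  pairwise_disjoint := ht.monotone.pairwise_disjoint_on_Ico_succ
  iUnion_eq := by
    refine Subset.antisymm (iUnion_subset fun j => Ico_subset_Ico (ht.monotone j.zero_le)
      (ht.monotone.ge_of_tendsto hv _)) fun x hx => mem_iUnion.2 ?_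
    obtain ⟨j, hj, hj'⟩ := Nat.exists_not_and_succ_of_not_zero_of_exists (p := fun j => x < t j)
      hx.1.not_gt (hv.eventually (lt_mem_nhds hx.2)).exists
    exact ⟨j, not_lt.1 hj, hj'⟩

theorem of_strictAnti {t : ℕ → α} {d : α} (ht : StrictAnti t) (hd : Tendsto t atTop (𝓝 d)) :
    IsIcoPartition (Ioo d (t 0)) fun j => (t (j + 1), t j) where
  lt j := ht j.lt_succ_self
  pairwise_disjoint := ht.antitone.pairwise_disjoint_on_Ico_succ
  iUnion_eq := by
    have hlt (j : ℕ) : d < t j :=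
      (ht.antitone.le_of_tendsto hd (j + 1)).trans_lt (ht j.lt_succ_self)
    refine Subset.antisymm (iUnion_subset fun j x hx => ⟨(hlt _).trans_le hx.1,
      hx.2.trans_le (ht.antitone j.zero_le)⟩) fun x hx => mem_iUnion.2 ?_
    obtain ⟨j, hj, hj'⟩ := Nat.exists_not_and_succ_of_not_zero_of_exists (p := fun j => t j ≤ x)
      hx.2.not_ge ((hd.eventually (gt_mem_nhds hx.1)).exists.imp fun _ => le_of_lt)
    exact ⟨j, hj', not_le.1 hj⟩

end IsIcoPartition

theorem exists_isIcoPartition_Ioo {α : Type*} [LinearOrder α] [TopologicalSpace α]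
    [OrderTopology α] [DenselyOrdered α] [FirstCountableTopology α] {d v : α} (h : d < v) :
    ∃ Q : ℕ → α × α, IsIcoPartition (Ioo d v) Q := by
  obtain ⟨t, ht, htmem, hlim⟩ := exists_seq_strictAnti_tendsto' h
  let s : ℕ → α := fun n => Nat.casesOn n v t
  have hs : StrictAnti s := strictAnti_nat_of_succ_lt <| by
    rintro (_ | n)
    exacts [(htmem 0).2, ht n.lt_succ_self]
  exact ⟨_, IsIcoPartition.of_strictAnti hs ((tendsto_add_atTop_iff_nat 1).1 hlim)⟩

theorem tendsto_div_two_pow (w : ℝ) : Tendsto (fun n : ℕ => w / 2 ^ n) atTop (𝓝 0) :=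
  tendsto_const_nhds.div_atTop (tendsto_pow_atTop_atTop_of_one_lt one_lt_two)

theorem exists_isIcoPartition_Ico {u v : ℝ} (h : u < v) :
    ∃ Q : ℕ → ℝ × ℝ, IsIcoPartition (Ico u v) Q ∧ (∀ j, (Q j).2 < v) ∧
      (∀ j, (Q j).2 - (Q j).1 ≤ (v - u) / 2) ∧ ∀ x < v, ∃ K, ∀ j ≥ K, x ≤ (Q j).1 := by
  let w : ℕ → ℝ := fun n => (v - u) / 2 ^ n
  have hw (n : ℕ) : 0 < w n := div_pos (sub_pos.2 h) (by positivity)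
  have hhalf (n : ℕ) : w (n + 1) = w n / 2 := by simp only [w, pow_succ, div_div]
  have hle (n : ℕ) : w n ≤ v - u := div_le_self (sub_pos.2 h).le (one_le_pow₀ one_le_two)
  have hmono : StrictMono fun n => v - w n :=
    strictMono_nat_of_lt_succ fun n => by linarith [hw n, hhalf n]
  have hlim : Tendsto (fun n => v - w n) atTop (𝓝 v) := by
    simpa only [sub_zero] using (tendsto_div_two_pow (v - u)).const_sub v
  have hzero : v - w 0 = u := by simp [w]
  refine ⟨_, hzero ▸ IsIcoPartition.of_strictMono hmono hlim, fun j => ?_, fun j => ?_,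
    fun x hx => ?_⟩
  · exact sub_lt_self v (hw (j + 1))
  · linarith [hhalf j, hle j]
  · exact eventually_atTop.1 ((hlim.eventually (lt_mem_nhds hx)).mono fun _ => le_of_lt)

theorem exists_isIcoPartition_Ico_diff {u v : ℝ} (h : u < v) {E : Set ℝ} (hE : E.Subsingleton) :
    ∃ Q : ℕ → ℝ × ℝ, IsIcoPartition (Ico u v \ E) Q := by
  by_cases hdisj : Disjoint (Ico u v) E
  · obtain ⟨Q, hQ, -⟩ := exists_isIcoPartition_Ico h
    exact ⟨Q, hdisj.sdiff_eq_left.symm ▸ hQ⟩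
  obtain ⟨d, hd, hdE⟩ := not_disjoint_iff.1 hdisj
  obtain rfl : E = {d} := hE.eq_singleton_of_mem hdE
  obtain ⟨R, hR⟩ := exists_isIcoPartition_Ioo hd.2
  rcases hd.1.eq_or_lt with rfl | hud
  · exact ⟨R, by rwa [Ico_sdiff_left]⟩
  obtain ⟨L, hL, -⟩ := exists_isIcoPartition_Ico hud
  have hsplit : Ico u v \ {d} = Ico u d ∪ Ioo d v := by
    rw [← Ico_union_Ico_eq_Ico hud.le hd.2.le, union_sdiff_distrib, Ico_sdiff_left,
      sdiff_singleton_eq_self right_notMem_Ico]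
  have hsides : Disjoint (Ico u d) (Ioo d v) :=
    disjoint_left.2 fun _ hx hx' => hx.2.not_gt hx'.1
  exact ⟨_, hsplit ▸ (hL.union hR hsides).comp_equiv Equiv.boolProdNatEquivNat.symm⟩

theorem exists_isIcoPartition_Icc_subset {u v : ℝ} (h : u < v) {E : Set ℝ} (hE : E.Subsingleton) :
    ∃ Q : ℕ → ℝ × ℝ, IsIcoPartition (Ico u v \ E) Q ∧
      ∀ j, Icc (Q j).1 (Q j).2 ⊆ Ico u v \ E := by
  obtain ⟨R, hR⟩ := exists_isIcoPartition_Ico_diff h hE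
  -- Splitting every piece once more moves all right endpoints inside a piece.
  choose T hT hTlt _ _ using fun j => exists_isIcoPartition_Ico (hR.lt j)
  have hRT : IsIcoPartition (Ico u v \ E) fun c : ℕ × ℕ => T c.1 c.2 :=
    hR.iUnion_eq ▸ IsIcoPartition.iUnion hR.pairwise_disjoint hT
  refine ⟨_, hRT.comp_equiv Nat.pairEquiv.symm, fun m x hx =>
    hR.subset _ ⟨?_, hx.2.trans_lt (hTlt _ _)⟩⟩
  exact ((hT _).subset _ (left_mem_Ico.2 ((hT _).lt _))).1.trans hx.1

/-- A partition of the interval `pairIco p` without the set `E` into half-open intervals of at most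
half its length, indexed by pairs: their closures avoid `E` and the right endpoint of `p`, and they
approach that endpoint as the first index grows. -/
structure IsSplitting (E : Set ℝ) (p : ℝ × ℝ) (J : ℕ × ℕ → ℝ × ℝ) : Prop
    extends IsIcoPartition (pairIco p \ E) J where
  Icc_subset : ∀ c, Icc (J c).1 (J c).2 ⊆ pairIco p \ E
  length_le : ∀ c, (J c).2 - (J c).1 ≤ (p.2 - p.1) / 2
  approaches : ∀ x < p.2, ∃ K, ∀ c : ℕ × ℕ, K ≤ c.1 → x ≤ (J c).1

theorem exists_isSplitting {p : ℝ × ℝ} (h : p.1 < p.2) {E : Set ℝ} (hE : E.Subsingleton) :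
    ∃ J, IsSplitting E p J := by
  obtain ⟨Q, hQ, -, hlength, happroach⟩ := exists_isIcoPartition_Ico h
  choose R hR hRsub using fun k => exists_isIcoPartition_Icc_subset (hQ.lt k) hE
  refine ⟨_, hQ.refine hR, fun c => ?_, fun c => ?_, fun x hx => ?_⟩
  · exact (hRsub c.1 c.2).trans (sdiff_subset_sdiff_left (hQ.subset _))
  · have hle := ((hR c.1).lt c.2).le
    have hleft := (hRsub c.1 c.2 (left_mem_Icc.2 hle)).1.1
    have hright := (hRsub c.1 c.2 (right_mem_Icc.2 hle)).1.2
    linarith [hlength c.1]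
  · obtain ⟨K, hK⟩ := happroach x hx
    refine ⟨K, fun c hc => (hK _ hc).trans ?_⟩
    exact (hRsub c.1 c.2 (left_mem_Icc.2 ((hR c.1).lt c.2).le)).1.1

/-- A scheme of half-open intervals, given by their endpoints: the intervals at the sons of a node
of length `n` split the interval at the node, discarding the points of `E n`. -/
def IsSplittingScheme (E : ℕ → Set ℝ) (I : List (ℕ × ℕ) → ℝ × ℝ) : Prop :=
  ∀ l, IsSplitting (E l.length) (I l) fun c => I (c :: l)

theorem exists_isSplittingScheme {E : ℕ → Set ℝ} (hE : ∀ n, (E n).Subsingleton) {p : ℝ × ℝ}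
    (hp : p.1 < p.2) : ∃ I, I [] = p ∧ IsSplittingScheme E I := by
  choose! J hJ using fun n (q : ℝ × ℝ) (hq : q.1 < q.2) => exists_isSplitting hq (hE n)
  let I : List (ℕ × ℕ) → ℝ × ℝ := fun l => List.rec p (fun c l q => J l.length q c) l
  have hlt (l : List (ℕ × ℕ)) : (I l).1 < (I l).2 := by
    induction l with
    | nil => exact hp
    | cons c l ih => exact (hJ _ _ ih).lt c
  exact ⟨I, rfl, fun l => hJ _ _ (hlt l)⟩

namespace IsSplittingScheme

variable {E : ℕ → Set ℝ} {I : List (ℕ × ℕ) → ℝ × ℝ} (hI : IsSplittingScheme E I)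
include hI

theorem lt (l : List (ℕ × ℕ)) : (I l).1 < (I l).2 := by
  have hchild := (hI l).Icc_subset (0, 0) (left_mem_Icc.2 ((hI l).lt (0, 0)).le)
  exact hchild.1.1.trans_lt hchild.1.2

theorem closure_subset (l : List (ℕ × ℕ)) (c : ℕ × ℕ) :
    closure (pairIco (I (c :: l))) ⊆ pairIco (I l) \ E l.length := by
  rw [closure_Ico (hI.lt _).ne]
  exact (hI l).Icc_subset c

theorem closureAntitone : CantorScheme.ClosureAntitone fun l => pairIco (I l) :=
  fun l c => (hI.closure_subset l c).trans sdiff_subset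

theorem disjoint : CantorScheme.Disjoint fun l => pairIco (I l) :=
  fun l => (hI l).pairwise_disjoint

theorem length_le (y : ℕ → ℕ × ℕ) (n : ℕ) :
    (I (PiNat.res y n)).2 - (I (PiNat.res y n)).1 ≤ ((I []).2 - (I []).1) / 2 ^ n := by
  induction n with
  | zero => simp
  | succ n ih =>
    rw [PiNat.res_succ, pow_succ, ← div_div]
    exact ((hI _).length_le _).trans (div_le_div_of_nonneg_right ih zero_le_two)

theorem vanishingDiam : CantorScheme.VanishingDiam fun l => pairIco (I l) := by
  intro y
  simp only [Real.ediam_Ico]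
  rw [← ENNReal.ofReal_zero]
  exact ENNReal.tendsto_ofReal <| squeeze_zero (fun n => (sub_pos.2 (hI.lt _)).le)
    (hI.length_le y) (tendsto_div_two_pow _)

theorem notMem_of_forall_mem {y : ℕ → ℕ × ℕ} {t : ℝ} (ht : ∀ n, t ∈ pairIco (I (PiNat.res y n)))
    (n : ℕ) : t ∉ E n := by
  have h := (hI.closure_subset (PiNat.res y n) (y n) (subset_closure (ht (n + 1)))).2
  rwa [PiNat.res_length] at h

theorem existsUnique_mem_branch (y : ℕ → ℕ × ℕ) : ∃! t, ∀ n, t ∈ pairIco (I (PiNat.res y n)) := by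
  have hdomain := hI.closureAntitone.map_of_vanishingDiam hI.vanishingDiam
    fun l => nonempty_Ico.2 (hI.lt l)
  refine existsUnique_of_exists_of_unique ⟨_, CantorScheme.map_mem ⟨y, hdomain ▸ mem_univ y⟩⟩
    fun s t hs ht => ?_
  refine eq_of_forall_dist_le fun ε hε => ?_
  obtain ⟨n, hn⟩ := hI.vanishingDiam.dist_lt ε hε y
  exact (hn s (hs n) t (ht n)).le

theorem exists_equiv {X : Type*} {f : X → ℝ} (hf : Injective f)
    (hrange : range f = pairIco (I []) \ ⋃ n, E n) :
    ∃ φ : X ≃ (ℕ → ℕ × ℕ), ∀ x y n,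
      f x ∈ pairIco (I (PiNat.res y n)) ↔ PiNat.res (φ x) n = PiNat.res y n := by
  have hmem (x : X) : f x ∈ pairIco (I []) \ ⋃ n, E n := hrange ▸ mem_range_self x
  refine exists_equiv_of_cantorScheme (A := fun l => f ⁻¹' pairIco (I l))
    (fun l c => preimage_mono (hI.closureAntitone.antitone l c))
    (fun l c c' hne => (hI.disjoint l hne).preimage f) (eq_univ_of_forall fun x => (hmem x).1)
    (fun l x hx => ?_) fun y => ?_
  · rw [← preimage_iUnion, mem_preimage, (hI l).iUnion_eq]
    exact ⟨hx, fun hxE => (hmem x).2 (mem_iUnion_of_mem _ hxE)⟩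
  · obtain ⟨t, ht, huniq⟩ := hI.existsUnique_mem_branch y
    obtain ⟨x, rfl⟩ : t ∈ range f := hrange ▸ ⟨ht 0, fun h =>
      (mem_iUnion.1 h).elim fun n => hI.notMem_of_forall_mem ht n⟩
    exact ⟨x, ht, fun x' hx' => hf (huniq _ hx')⟩

end IsSplittingScheme

/-- An embedding of `X` into an ordered space that carries the right half-open interval topology,
whose neighbourhoods of `a` are generated by the intervals `[a, b)`. -/
structure IsSorgenfreyEmbedding {X α : Type*} [TopologicalSpace X] [Preorder α] [TopologicalSpace α]
    (f : X → α) : Prop where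
  injective : Injective f
  nhds_eq : ∀ x, 𝓝 x = comap f (𝓝[≥] f x)

namespace IsSorgenfreyEmbedding

theorem comp_isEmbedding {X Y α : Type*} [TopologicalSpace X] [TopologicalSpace Y] [Preorder α]
    [TopologicalSpace α] {f : X → α} (hf : IsSorgenfreyEmbedding f) {g : Y → X}
    (hg : IsEmbedding g) : IsSorgenfreyEmbedding (f ∘ g) where
  injective := hf.injective.comp hg.injective
  nhds_eq y := by rw [hg.nhds_eq_comap, hf.nhds_eq, comap_comap, comp_apply]

variable {X α β : Type*} [TopologicalSpace X] [LinearOrder α] [TopologicalSpace α] {f : X → α}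

theorem isOpen_preimage_Ico [ClosedIciTopology α] (hf : IsSorgenfreyEmbedding f) (a b : α) :
    IsOpen (f ⁻¹' Ico a b) := by
  refine isOpen_iff_mem_nhds.2 fun x hx => ?_
  rw [hf.nhds_eq]
  exact preimage_mem_comap (Ico_mem_nhdsGE_of_mem hx)

variable [OrderTopology α]

theorem exists_preimage_Ico_subset [NoMaxOrder α] (hf : IsSorgenfreyEmbedding f) {x : X} {U : Set X}
    (hU : U ∈ 𝓝 x) : ∃ b > f x, f ⁻¹' Ico (f x) b ⊆ U := by
  rw [hf.nhds_eq] at hU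
  obtain ⟨V, hV, hVU⟩ := hU
  obtain ⟨b, hb, hbV⟩ := mem_nhdsGE_iff_exists_Ico_subset.1 hV
  exact ⟨b, hb, (preimage_mono hbV).trans hVU⟩

theorem strictMono_comp [LinearOrder β] [TopologicalSpace β] [OrderTopology β]
    (hf : IsSorgenfreyEmbedding f) {g : α → β} (hg : StrictMono g)
    (hrange : (range g).OrdConnected) : IsSorgenfreyEmbedding (g ∘ f) where
  injective := hg.injective.comp hf.injective
  nhds_eq x := by
    have hIci : g ⁻¹' Ici (g (f x)) = Ici (f x) := ext fun _ => hg.le_iff_le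
    have hnhds : 𝓝[≥] f x = comap g (𝓝[≥] g (f x)) := by
      rw [nhdsWithin, nhdsWithin, comap_inf, comap_principal, hIci,
        (hg.isEmbedding_of_ordConnected hrange).nhds_eq_comap]
    rw [hf.nhds_eq, hnhds, comap_comap, comp_apply]

end IsSorgenfreyEmbedding

theorem IsSplittingScheme.isPairCode {X : Type*} [TopologicalSpace X] {f : X → ℝ}
    (hf : IsSorgenfreyEmbedding f) {E : ℕ → Set ℝ} {I : List (ℕ × ℕ) → ℝ × ℝ}
    (hI : IsSplittingScheme E I) {φ : X ≃ (ℕ → ℕ × ℕ)}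
    (hφ : ∀ x y n, f x ∈ pairIco (I (PiNat.res y n)) ↔ PiNat.res (φ x) n = PiNat.res y n) :
    IsPairCode φ where
  continuous := continuous_of_forall_mem_iff_res_eq (A := fun l => f ⁻¹' pairIco (I l))
    (fun _ => hf.isOpen_preimage_Ico _ _) hφ
  grows p U hU := by
    obtain ⟨b, hb, hbU⟩ := hf.exists_preimage_Ico_subset hU
    obtain ⟨N, hN⟩ := hI.vanishingDiam.dist_lt (b - f p) (sub_pos.2 hb) (φ p)
    have hmem {x : X} {n : ℕ} (hx : ∀ i < n, φ x i = φ p i) :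
        f x ∈ pairIco (I (PiNat.res (φ p) n)) := (hφ x (φ p) n).2 (PiNat.res_eq_res.2 hx)
    refine ⟨N, fun n hn => ?_⟩
    obtain ⟨K, hK⟩ := (hI (PiNat.res (φ p) n)).approaches (f p) (hmem fun _ _ => rfl).2
    refine ⟨K, fun x hx hxK => hbU ⟨?_, ?_⟩⟩
    · have hnext : f x ∈ pairIco (I (φ x n :: PiNat.res (φ p) n)) :=
        PiNat.res_eq_res.2 hx ▸ (hφ x (φ x) (n + 1)).2 rfl
      exact (hK _ hxK).trans hnext.1
    · have hdist := hN (f x) (hmem fun i hi => hx i (hi.trans_le hn)) (f p) (hmem fun _ _ => rfl)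
      linarith [(abs_lt.1 hdist).2]

theorem IsSorgenfreyEmbedding.hasPairCode {X : Type*} [TopologicalSpace X] {f : X → ℝ}
    (hf : IsSorgenfreyEmbedding f) {u v : ℝ} (huv : u < v) (hsub : range f ⊆ Ico u v)
    (hcount : (Ico u v \ range f).Countable) : HasPairCode X := by
  obtain ⟨d, hd⟩ := countable_iff_exists_subset_range.1 hcount
  let E : ℕ → Set ℝ := fun n => {d n} \ range f
  obtain ⟨I, hroot, hI⟩ := exists_isSplittingScheme (E := E)
    (fun n => subsingleton_singleton.anti sdiff_subset) (p := (u, v)) huv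
  have hrange : range f = pairIco (I []) \ ⋃ n, E n := by
    rw [hroot, ← iUnion_sdiff, iUnion_singleton_eq_range]
    ext t
    refine ⟨fun ht => ⟨hsub ht, fun h => h.2 ht⟩, fun ⟨ht, hE⟩ => ?_⟩
    by_contra hnot
    exact hE ⟨hd ⟨ht, hnot⟩, hnot⟩
  obtain ⟨φ, hφ⟩ := hI.exists_equiv hf.injective hrange
  exact ⟨φ, hI.isPairCode hf hφ⟩

/-- The real number underlying a point of the Sorgenfrey line. -/
def SorgenfreyLine.toReal : SorgenfreyLine ≃ ℝ := Equiv.refl ℝ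

theorem SorgenfreyLine.isSorgenfreyEmbedding_toReal : IsSorgenfreyEmbedding toReal where
  injective := toReal.injective
  nhds_eq x := by
    refine le_antisymm ?_ ?_
    · rw [((nhdsGE_basis_Ico (toReal x)).comap toReal).ge_iff]
      exact fun b hb => IsOpen.mem_nhds
        (TopologicalSpace.isOpen_generateFrom_of_mem ⟨toReal x, b, rfl⟩) ⟨le_rfl, hb⟩
    · rw [TopologicalSpace.nhds_generateFrom, le_iInf₂_iff]
      rintro _ ⟨hx, a, b, rfl⟩
      exact le_principal_iff.2 (preimage_mem_comap (Ico_mem_nhdsGE_of_mem hx))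

theorem hasPairCode_of_countable_compl {S : Set SorgenfreyLine} (hS : Sᶜ.Countable) :
    HasPairCode S := by
  let g : SorgenfreyLine → ℝ := Real.sigmoid ∘ SorgenfreyLine.toReal
  have hg : IsSorgenfreyEmbedding g := SorgenfreyLine.isSorgenfreyEmbedding_toReal.strictMono_comp
    Real.sigmoid_strictMono (Real.range_sigmoid ▸ ordConnected_Ioo)
  have hg_range : range g = Ioo 0 1 := by
    rw [EquivLike.range_comp, Real.range_sigmoid]
  have hrange : range (g ∘ ((↑) : S → SorgenfreyLine)) = g '' S := by
    rw [range_comp, Subtype.range_coe]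
  refine (hg.comp_isEmbedding IsEmbedding.subtypeVal).hasPairCode zero_lt_one ?_ ?_
  · rw [hrange]
    exact (image_subset_range g S).trans (hg_range.trans_subset Ioo_subset_Ico_self)
  · refine ((hS.image g).insert 0).mono ?_
    rw [hrange]
    rintro t ⟨ht, htS⟩
    rcases ht.1.eq_or_lt with rfl | hpos
    · exact mem_insert 0 _
    · obtain ⟨x, rfl⟩ : t ∈ range g := hg_range ▸ ⟨hpos, ht.2⟩
      exact Or.inr (mem_image_of_mem g fun hx => htS (mem_image_of_mem g hx))

end PiTree

theorem mainTheorem3 {A : Type*} [Nonempty A] [Countable A]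
    (X : A → Type*) [∀ α, TopologicalSpace (X α)]
    (hX : ∀ α, Nonempty (X α ≃ₜ (ℕ → ℕ)) ∨
      ∃ S : Set PiTree.SorgenfreyLine, Sᶜ.Countable ∧ Nonempty (X α ≃ₜ S)) :
    PiTree.HasPiTree (∀ α, X α) := by
  refine (PiTree.HasPairCode.pi fun α => ?_).hasPiTree
  rcases hX α with ⟨⟨h⟩⟩ | ⟨S, hS, ⟨h⟩⟩
  · exact PiTree.hasPairCode_nat_nat.of_homeomorph h
  · exact (PiTree.hasPairCode_of_countable_compl hS).of_homeomorph h
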